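/- **Theorem (directed triangle inequality).** A *prefix machine* is a partial recursive function $U$ taking a program $p\in\{0,1\}^*$ and a condition $y\in\{0,1\}^*$ to an output in $\{0,1\}^*$, such that for every fixed $y$ the set of programs $p$ for which $U(p,y)$ is defined is prefix-free. A *reference machine* is a prefix machine $U$ that simulates every prefix machine $V$ with constant overhead: there is a constant $c_V$ such that whenever $V(p,y)=x$ there is $q$ with $U(q,y)=x$ and $l(q)\le l(p)+c_V$, where $l$ denotes length. Let $U$ be a reference machine. Put $K(x\mid y)=\min\{l(p):U(p,y)=x\}$, and let $x^*$ be the lexicographically first among the shortest programs $p$ with $U(p,\epsilon)=x$, where $\epsilon$ is the empty string. Let $\langle\cdot,\cdot\rangle:\{0,1\}^*\times\{0,1\}^*\to\{0,1\}^*$ be a computable one-to-one pairing function and put $K(x,z\mid y)=K(\langle x,z\rangle\mid y)$. Then there is a constant $c$ (depending only on $U$ and the pairing function) such that for all $x,y,z\in\{0,1\}^*$, \[ K(x\mid y^*)\;\le\;K(x,z\mid y^*)+c \qquad\text{and}\qquad K(x,z\mid y^*)\;\le\;K(z\mid y^*)+K(x\mid z^*)+c . \] -/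

import Mathlib

namespace PrefixComplexity

/-- Finite binary strings. -/
abbrev Str : Type := List Bool

/-- A machine with auxiliary input: `U p y` is the output (if any) on program `p`, given the
auxiliary string `y`. -/
abbrev Machine : Type := Str → Str →. Str

/-- A prefix machine: the partial function computed is partial recursive, and for every auxiliary
input the set of halting programs is prefix-free. -/
structure IsPrefixMachine (U : Machine) : Prop where
  partrec : Partrec₂ U
  prefixFree : ∀ y p q : Str, (U p y).Dom → (U q y).Dom → p <+: q → p = q

/-- A reference (universal) prefix machine: it simulates every prefix machine `V`, at the cost of a
constant number `c` of additional program bits, where `c` depends on `V` only. In particular this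
holds for a prefix machine `U` such that each `V` has an index string `w` with
`U (w ++ p) y = V p y` for all `p` and `y`. -/
structure IsReferenceMachine (U : Machine) : Prop extends IsPrefixMachine U where
  simulates : ∀ V : Machine, IsPrefixMachine V →
    ∃ c : ℕ, ∀ p y x : Str, x ∈ V p y → ∃ q : Str, x ∈ U q y ∧ q.length ≤ p.length + c

/-! The next definitions and facts only show that reference machines exist: each code of a partial
recursive function is turned effectively into a prefix machine, which agrees with the function
where that is already prefix-free, and programs are preceded by an index. -/

/-- One step of a search through all halting computations of `f` (computed by the code `c` with
arguments `(program, y)`) whose programs are comparable with `p`: stage `n` codes a running time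
and a program `r`. -/
def searchStep (c : Nat.Partrec.Code) (p y : Str) (n : ℕ) : Option (Str × Option Str) :=
  (Encodable.decode (α := Str) n.unpair.2).bind fun r =>
    if r.take p.length = p ∨ p.take r.length = r then
      (Nat.Partrec.Code.evaln n.unpair.1 c (Encodable.encode (r, y))).map
        fun v => (r, Encodable.decode (α := Str) v)
    else none

/-- The prefix machine obtained from a code: `p` halts only when it is the first comparable program
found. -/
def filterMachine (c : Nat.Partrec.Code) : Machine := fun p y =>
  (Nat.rfindOpt (searchStep c p y)).bind fun a =>
    ((if a.1 = p then a.2 else none : Option Str) : Part Str)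

theorem searchStep_computable (c : Nat.Partrec.Code) :
    Computable₂ fun (a : Str × Str) (n : ℕ) => searchStep c a.1 a.2 n := by
  refine Primrec.to_comp ?_
  refine Primrec.option_bind
    (Primrec.decode.comp (Primrec.snd.comp (Primrec.unpair.comp Primrec.snd))) ?_
  have hp : Primrec fun a : ((Str × Str) × ℕ) × Str => a.1.1.1 :=
    Primrec.fst.comp (Primrec.fst.comp Primrec.fst)
  have hy : Primrec fun a : ((Str × Str) × ℕ) × Str => a.1.1.2 :=
    Primrec.snd.comp (Primrec.fst.comp Primrec.fst)
  have hr : Primrec fun a : ((Str × Str) × ℕ) × Str => a.2 := Primrec.snd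
  have hk : Primrec fun a : ((Str × Str) × ℕ) × Str => a.1.2.unpair.1 :=
    Primrec.fst.comp (Primrec.unpair.comp (Primrec.snd.comp Primrec.fst))
  refine Primrec.ite (PrimrecPred.or
    (Primrec.eq.comp (Primrec.list_take.comp (Primrec.list_length.comp hp) hr) hp)
    (Primrec.eq.comp (Primrec.list_take.comp (Primrec.list_length.comp hr) hp) hr)) ?_
    (Primrec.const none)
  refine Primrec.option_map
    (Nat.Partrec.Code.primrec_evaln.comp
      ((hk.pair (Primrec.const c)).pair (Primrec.encode.comp (hr.pair hy)))) ?_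
  exact (hr.comp Primrec.fst).pair (Primrec.decode.comp Primrec.snd)

theorem mem_searchStep {c : Nat.Partrec.Code} {p y : Str} {n : ℕ} {a : Str × Option Str}
    (h : a ∈ searchStep c p y n) :
    (a.1 <+: p ∨ p <+: a.1) ∧ Encodable.decode (α := Str) n.unpair.2 = some a.1 ∧
      ∃ v ∈ Nat.Partrec.Code.evaln n.unpair.1 c (Encodable.encode (a.1, y)),
        a.2 = Encodable.decode (α := Str) v := by
  simp only [searchStep, Option.mem_def, Option.bind_eq_some_iff] at h
  obtain ⟨r, hr, h⟩ := h
  split_ifs at h with hc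
  · simp only [Option.map_eq_some_iff] at h
    obtain ⟨v, hv, rfl⟩ := h
    refine ⟨?_, hr, v, hv, rfl⟩
    rcases hc with hc | hc
    · exact Or.inr (hc ▸ List.take_prefix _ _)
    · exact Or.inl (hc ▸ List.take_prefix _ _)

theorem searchStep_of {c : Nat.Partrec.Code} {p y r : Str} {n v : ℕ} (hr : r <+: p ∨ p <+: r)
    (hd : Encodable.decode (α := Str) n.unpair.2 = some r)
    (hv : v ∈ Nat.Partrec.Code.evaln n.unpair.1 c (Encodable.encode (r, y))) :
    (r, Encodable.decode (α := Str) v) ∈ searchStep c p y n := by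
  have hc : r.take p.length = p ∨ p.take r.length = r := by
    rcases hr with h | h
    · exact Or.inr (List.prefix_iff_eq_take.1 h).symm
    · exact Or.inl (List.prefix_iff_eq_take.1 h).symm
  simp only [searchStep, Option.mem_def, hd, Option.bind_some, if_pos hc]
  rw [Option.mem_def.1 hv]
  rfl

/-- The first successful stage of an unbounded search. -/
theorem rfindOpt_first {α : Type*} {f : ℕ → Option α} {a : α} (h : a ∈ Nat.rfindOpt f) :
    ∃ n, a ∈ f n ∧ ∀ m, m < n → f m = none := by
  obtain ⟨n, hn, ha⟩ := Part.mem_bind_iff.1 h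
  refine ⟨n, Part.mem_coe.1 ha, fun m hm => ?_⟩
  have := Nat.rfind_min hn hm
  simpa using this

theorem filterMachine_isPrefix (c : Nat.Partrec.Code) : IsPrefixMachine (filterMachine c) := by
  refine ⟨?_, ?_⟩
  · refine Partrec.bind (Partrec.rfindOpt (searchStep_computable c)) ?_
    refine Computable.ofOption
      (f := fun b : (Str × Str) × (Str × Option Str) => if b.2.1 = b.1.1 then b.2.2 else none) ?_
    refine Primrec.to_comp (Primrec.ite (Primrec.eq.comp (Primrec.fst.comp Primrec.snd)
      (Primrec.fst.comp Primrec.fst)) (Primrec.snd.comp Primrec.snd) (Primrec.const none))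
  · have key : ∀ y p : Str, (filterMachine c p y).Dom → ∃ n,
        (∃ o, (p, o) ∈ searchStep c p y n) ∧ ∀ m, m < n → searchStep c p y m = none := by
      intro y p hp
      obtain ⟨x, hx⟩ := Part.dom_iff_mem.1 hp
      obtain ⟨⟨r, o⟩, ha, hx⟩ := Part.mem_bind_iff.1 hx
      obtain ⟨n, hn, hm⟩ := rfindOpt_first ha
      by_cases hr : r = p
      · subst hr
        exact ⟨n, ⟨o, hn⟩, hm⟩
      · simp [hr] at hx
    have one : ∀ y p q : Str, (p <+: q ∨ q <+: p) → ∀ n m,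
        (∃ o, (p, o) ∈ searchStep c p y n) → (∀ k, k < m → searchStep c q y k = none) → m ≤ n := by
      intro y p q hpq n m ⟨o, ho⟩ hk
      by_contra hlt
      obtain ⟨_, hd, v, hv, _⟩ := mem_searchStep ho
      have := searchStep_of hpq hd hv
      rw [hk n (by omega)] at this
      simp at this
    intro y p q hp hq hpq
    obtain ⟨n, hn, hn'⟩ := key y p hp
    obtain ⟨m, hm, hm'⟩ := key y q hq
    have e : n = m := le_antisymm (one y q p (Or.inr hpq) m n hm hn') (one y p q (Or.inl hpq) n m hn hm')
    subst e
    obtain ⟨o, ho⟩ := hn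
    obtain ⟨o', ho'⟩ := hm
    have h1 := (mem_searchStep ho).2.1
    have h2 := (mem_searchStep ho').2.1
    rw [h1] at h2
    exact Option.some.inj h2

theorem mem_filterMachine {c : Nat.Partrec.Code} {f : Machine}
    (hc : ∀ r y, Nat.Partrec.Code.eval c (Encodable.encode (r, y)) = (f r y).map Encodable.encode)
    {p y x : Str} (hx : x ∈ f p y)
    (hp : ∀ r, (r <+: p ∨ p <+: r) → (f r y).Dom → r = p) : x ∈ filterMachine c p y := by
  have hv : Encodable.encode x ∈ Nat.Partrec.Code.eval c (Encodable.encode (p, y)) := by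
    rw [hc]; exact Part.mem_map _ hx
  obtain ⟨k, hk⟩ := Nat.Partrec.Code.evaln_complete.1 hv
  have hs := searchStep_of (c := c) (p := p) (y := y) (r := p)
    (n := Nat.pair k (Encodable.encode p)) (v := Encodable.encode x) (Or.inl List.prefix_rfl)
    (by simp) (by simpa using hk)
  obtain ⟨a, ha⟩ := Part.dom_iff_mem.1 (Nat.rfindOpt_dom.2 ⟨_, _, hs⟩)
  obtain ⟨n, hn, _⟩ := rfindOpt_first ha
  obtain ⟨hr, _, v, hv, hav⟩ := mem_searchStep hn
  have hv' := Nat.Partrec.Code.evaln_sound hv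
  rw [hc] at hv'
  obtain ⟨w, hw, rfl⟩ := (Part.mem_map_iff _).1 hv'
  have e : a.1 = p := hp _ hr (Part.dom_iff_mem.2 ⟨w, hw⟩)
  rw [e] at hw
  refine Part.mem_bind_iff.2 ⟨a, ha, ?_⟩
  simp [e, hav, Part.mem_unique hw hx]

/-- Run the program `p` on the machine of code number `i`, given `w = 1…10p` with `i` ones. -/
def interp : Machine := fun w y =>
  (Nat.Partrec.Code.eval (Denumerable.ofNat Nat.Partrec.Code (w.takeWhile id).length)
    (Encodable.encode ((w.dropWhile id).tail, y))).bind fun v =>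
      ((if w.dropWhile id = [] then none else Encodable.decode (α := Str) v : Option Str) :
        Part Str)

theorem interp_partrec : Partrec₂ interp := by
  have hd : Primrec fun a : Str × Str => a.1.dropWhile id :=
    (Primrec.list_dropWhile Primrec.id).comp Primrec.fst
  refine Partrec.bind (Nat.Partrec.Code.eval_part.comp (Primrec.to_comp ?_) (Primrec.to_comp ?_)) ?_
  · exact (Primrec.ofNat Nat.Partrec.Code).comp (Primrec.list_length.comp
      ((Primrec.list_takeWhile Primrec.id).comp Primrec.fst))
  · exact Primrec.encode.comp ((Primrec.list_tail.comp hd).pair Primrec.snd)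
  · refine Computable.ofOption (f := fun b : (Str × Str) × ℕ =>
      if b.1.1.dropWhile id = [] then none else Encodable.decode (α := Str) b.2) ?_
    exact Primrec.to_comp (Primrec.ite (Primrec.eq.comp (hd.comp Primrec.fst) (Primrec.const []))
      (Primrec.const none) (Primrec.decode.comp Primrec.snd))

theorem interp_eq (i : ℕ) (p y : Str) : interp (List.replicate i true ++ false :: p) y =
    (Nat.Partrec.Code.eval (Denumerable.ofNat Nat.Partrec.Code i) (Encodable.encode (p, y))).bind fun v =>
      ((Encodable.decode (α := Str) v : Option Str) : Part Str) := by
  have h1 : (List.replicate i true ++ false :: p).dropWhile id = false :: p := by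
    induction i with
    | zero => simp
    | succ n ih => simp [List.replicate_succ]
  have h2 : (List.replicate i true ++ false :: p).takeWhile id = List.replicate i true := by
    induction i with
    | zero => simp
    | succ n ih => simp [List.replicate_succ]
  simp [interp, h1, h2]

theorem interp_dom {w y : Str} (h : (interp w y).Dom) :
    ∃ i p, w = List.replicate i true ++ false :: p := by
  have hw : w.dropWhile id ≠ [] := by
    intro e
    obtain ⟨x, hx⟩ := Part.dom_iff_mem.1 h
    simp [interp, e] at hx
  clear h
  induction w with
  | nil => simp at hw
  | cons b w ih =>
    cases b with
    | false => exact ⟨0, w, rfl⟩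
    | true =>
      obtain ⟨i, p, rfl⟩ := ih (by simpa using hw)
      exact ⟨i + 1, p, by simp [List.replicate_succ]⟩

theorem replicate_prefix {i j : ℕ} {p q : Str}
    (h : List.replicate i true ++ false :: p <+: List.replicate j true ++ false :: q) :
    i = j ∧ p <+: q := by
  induction i generalizing j with
  | zero => cases j <;> simp_all [List.replicate_succ, List.cons_prefix_cons]
  | succ n ih =>
    cases j with
    | zero => simp [List.replicate_succ, List.cons_prefix_cons] at h
    | succ m =>
      simp only [List.replicate_succ, List.cons_append, List.cons_prefix_cons, true_and] at h
      obtain ⟨e, h2⟩ := ih h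
      exact ⟨congrArg (· + 1) e, h2⟩

theorem exists_code_of_partrec {f : Machine} (hf : Partrec₂ f) : ∃ c : Nat.Partrec.Code, ∀ r y,
    Nat.Partrec.Code.eval c (Encodable.encode (r, y)) = (f r y).map Encodable.encode := by
  obtain ⟨c, hc⟩ := Nat.Partrec.Code.exists_code.1 hf
  refine ⟨c, fun r y => ?_⟩
  rw [hc]
  simp

/-- A reference machine exists. -/
theorem exists_isReferenceMachine : ∃ U : Machine, IsReferenceMachine U := by
  obtain ⟨u, hu⟩ := exists_code_of_partrec interp_partrec
  refine ⟨filterMachine u, filterMachine_isPrefix u, fun V hV => ?_⟩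
  obtain ⟨c, hc⟩ := exists_code_of_partrec hV.partrec
  have hi : ∀ p y, interp (List.replicate (Encodable.encode c) true ++ false :: p) y = V p y := by
    intro p y
    rw [interp_eq, Denumerable.ofNat_encode, hc]
    ext x
    simp
  refine ⟨Encodable.encode c + 1, fun p y x hx =>
    ⟨List.replicate (Encodable.encode c) true ++ false :: p, mem_filterMachine hu ?_ ?_, ?_⟩⟩
  · rw [hi]; exact hx
  · intro r hr hd
    obtain ⟨j, q, rfl⟩ := interp_dom hd
    have hx' := Part.dom_iff_mem.2 ⟨x, hx⟩
    rcases hr with hr | hr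
    · obtain ⟨rfl, h⟩ := replicate_prefix hr
      rw [hi] at hd
      rw [hV.prefixFree y q p hd hx' h]
    · obtain ⟨rfl, h⟩ := replicate_prefix hr
      rw [hi] at hd
      rw [hV.prefixFree y p q hx' hd h]
  · simp; omega

/-- Every string has a program on a reference machine, under every condition, so that the minima
below are taken over nonempty sets. -/
theorem IsReferenceMachine.exists_program {U : Machine} (hU : IsReferenceMachine U) (x y : Str) :
    ∃ p : Str, x ∈ U p y := by
  have hV : IsPrefixMachine fun p _ => ((if p = [] then some x else none : Option Str) : Part Str) := by
    refine ⟨?_, ?_⟩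
    · refine Computable.ofOption (f := fun a : Str × Str => if a.1 = [] then some x else none) ?_
      exact (Primrec.ite (Primrec.eq.comp Primrec.fst (Primrec.const []))
        (Primrec.const (some x)) (Primrec.const none)).to_comp
    · intro _ p q hp hq _
      have key : ∀ r : Str, ((if r = [] then some x else none : Option Str) : Part Str).Dom →
          r = [] := by
        intro r hr
        by_contra h
        simp [h] at hr
      rw [key p hp, key q hq]
  obtain ⟨c, hc⟩ := hU.simulates _ hV
  obtain ⟨q, hq, _⟩ := hc [] y x (by simp)
  exact ⟨q, hq⟩

/-- The conditional prefix Kolmogorov complexity `K(x | y)` with respect to `U`: the length of a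
shortest program that outputs `x` given `y`. -/
noncomputable def condK (U : Machine) (x y : Str) : ℕ :=
  sInf {n : ℕ | ∃ p : Str, p.length = n ∧ x ∈ U p y}

/-- The length-increasing lexicographic order on strings (`ε, 0, 1, 00, 01, …`) is well-founded. -/
theorem wellFounded_shortlex : WellFounded (List.Shortlex ((· < ·) : Bool → Bool → Prop)) :=
  List.Shortlex.wf wellFounded_lt

/-- `x*`: the first program for `x` (with empty condition) in the length-increasing lexicographic
order, that is, the lexicographically first among the shortest programs for `x`. -/
noncomputable def shortestProgram (U : Machine) (hU : IsReferenceMachine U) (x : Str) : Str :=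
  wellFounded_shortlex.min {p : Str | x ∈ U p []} (hU.exists_program x [])

/-- An effective one-one encoding `⟨x, z⟩` of pairs of strings as strings. -/
structure IsPairing (pair : Str → Str → Str) : Prop where
  computable : Computable₂ pair
  injective : Function.Injective2 pair

/-- Such encodings exist. -/
theorem exists_pairing : ∃ pair : Str → Str → Str, IsPairing pair :=
  ⟨fun x y => List.replicate (Encodable.encode (x, y)) true, by
    have : Primrec fun n : ℕ => List.replicate n true :=
      (Primrec.list_map Primrec.list_range (Primrec.const true).to₂).of_eq fun n => by simp
    exact (this.comp Primrec.encode).to_comp, fun a b c d h => by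
    have := congrArg List.length h
    simp at this
    exact this⟩

end PrefixComplexity

/-!
The mathematical content is the additivity of prefix complexity,
`K(b) + K(a | b*) = K(a, b) + O(1)`. Granted that, both `K(x, z | y*) + K(y)` and the sum of
`K(z | y*) + K(y)` and `K(x | z*)` are compared with unconditional complexities:

* `K(x, z | y*) + K(y) ≤ K(x, y, z) ≤ K(z) + K(x, y | z*) ≤ K(z) + K(x | z*) + K(y | z*)`,
* `K(z) + K(y | z*) ≤ K(y, z) ≤ K(y) + K(z | y*)`,

up to constants, and the sum of the two chains is the assertion. The detour is needed because `z*`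
cannot in general be computed from `y*` and a program for `z`.

The easy half `K(a, b) ≤ K(b) + K(a | b*)`, as well as `K(x, y | s) ≤ K(x | s) + K(y | s)`, holds
because self-delimiting programs can be concatenated
(`IsReferenceMachine.exists_condK_pair_le`). The hard half is
`IsReferenceMachine.exists_condK_shortestProgram_add_le`. It rests on an effective converse of
Kraft's inequality (`IsReferenceMachine.exists_condK_le_of_requests`): an enumerable list of
requests `(k, x)` with `∑ 2⁻ᵏ ≤ 1` is served by programs of length `k + O(1)`, since consecutive
intervals of lengths `2⁻ᵏ` in `[0, 1)` contain disjoint dyadic intervals of half the length. This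
gives the coding theorem (`IsReferenceMachine.exists_tsum_mul_two_pow_condK_le`), by which the
programs for pairs `⟨·, b⟩` have total weight at most `2 ^ (c - K(b))`. Given `b*`, the number
`K(b) = l(b*)` is known, so each program `p` for a pair `⟨a, b⟩` can be turned into a request for
`a` of length `l(p) - K(b) + c`, and the total weight of these requests is again at most one.

Machines need to be prefix-free only under the conditions of interest
(`IsReferenceMachine.exists_condK_le`), because `filterMachine` repairs the others.
-/

namespace PrefixComplexity

open scoped ENNReal

/-! ### Kraft's inequality -/

theorem uniquelyDecodable_of_prefixFree {α : Type*} {S : Set (List α)} (h0 : [] ∉ S)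
    (h : ∀ p ∈ S, ∀ q ∈ S, p <+: q → p = q) : InformationTheory.UniquelyDecodable S := by
  intro L₁
  induction L₁ with
  | nil =>
    intro L₂ _ h₂ he
    cases L₂ with
    | nil => rfl
    | cons w L =>
      have : w = [] := by
        simp only [List.flatten_nil, List.flatten_cons] at he
        exact (List.append_eq_nil_iff.1 he.symm).1
      exact absurd (this ▸ h₂ w (by simp)) h0
  | cons v L ih =>
    intro L₂ h₁ h₂ he
    cases L₂ with
    | nil =>
      have : v = [] := by
        simp only [List.flatten_nil, List.flatten_cons] at he
        exact (List.append_eq_nil_iff.1 he).1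
      exact absurd (this ▸ h₁ v (by simp)) h0
    | cons w M =>
      simp only [List.flatten_cons] at he
      have hv : v ∈ S := h₁ v (by simp)
      have hw : w ∈ S := h₂ w (by simp)
      have e : v = w := by
        rcases List.prefix_or_prefix_of_prefix (List.prefix_append v L.flatten)
          (he ▸ List.prefix_append w M.flatten) with h' | h'
        · exact h v hv w hw h'
        · exact (h w hw v hv h').symm
      subst e
      rw [ih M (fun u hu => h₁ u (by simp [hu])) (fun u hu => h₂ u (by simp [hu]))
        (List.append_cancel_left he)]

/-- Kraft's inequality for an arbitrary prefix-free set of binary strings. -/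
theorem tsum_prefixFree_le_one (S : Set Str) (h : ∀ p ∈ S, ∀ q ∈ S, p <+: q → p = q) :
    ∑' p, S.indicator (fun p => (2⁻¹ : ℝ≥0∞) ^ p.length) p ≤ 1 := by
  classical
  rw [ENNReal.tsum_eq_iSup_sum]
  refine iSup_le fun F => ?_
  rw [Finset.sum_indicator_eq_sum_filter]
  set T := F.filter (· ∈ S) with hT
  have hTS : ∀ p ∈ T, p ∈ S := fun p hp => (Finset.mem_filter.1 hp).2
  by_cases h0 : [] ∈ T
  · have : T = {[]} := Finset.eq_singleton_iff_unique_mem.2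
      ⟨h0, fun p hp => (h [] (hTS _ h0) p (hTS _ hp) List.nil_prefix).symm⟩
    simp [this]
  · have hud : InformationTheory.UniquelyDecodable (T : Set Str) :=
      uniquelyDecodable_of_prefixFree (by simpa using h0)
        fun p hp q hq => h p (hTS _ hp) q (hTS _ hq)
    have hk := InformationTheory.kraft_mcmillan_inequality hud
    have hk' := ENNReal.ofReal_le_ofReal hk
    rw [ENNReal.ofReal_sum_of_nonneg fun _ _ => by positivity] at hk'
    refine le_trans (le_of_eq (Finset.sum_congr rfl fun p _ => ?_)) (hk'.trans_eq (by simp))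
    rw [ENNReal.ofReal_pow (by positivity)]
    congr 1
    simp [ENNReal.ofReal_inv_of_pos]

/-! ### Programs and complexity -/

variable {U : Machine} {α : Type*} [Primcodable α]

theorem condK_le {p s x : Str} (h : x ∈ U p s) : condK U x s ≤ p.length :=
  Nat.sInf_le ⟨p, rfl, h⟩

theorem IsReferenceMachine.exists_length_eq_condK (hU : IsReferenceMachine U) (x s : Str) :
    ∃ p : Str, x ∈ U p s ∧ p.length = condK U x s := by
  obtain ⟨p, hp⟩ := hU.exists_program x s
  obtain ⟨q, hq, hx⟩ := Nat.sInf_mem (s := {n : ℕ | ∃ p : Str, p.length = n ∧ x ∈ U p s})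
    ⟨p.length, p, rfl, hp⟩
  exact ⟨q, hx, hq⟩

theorem mem_shortestProgram (hU : IsReferenceMachine U) (x : Str) :
    x ∈ U (shortestProgram U hU x) [] :=
  wellFounded_shortlex.min_mem {p : Str | x ∈ U p []} (hU.exists_program x [])

theorem length_shortestProgram (hU : IsReferenceMachine U) (x : Str) :
    (shortestProgram U hU x).length = condK U x [] := by
  refine le_antisymm ?_ (condK_le (mem_shortestProgram hU x))
  obtain ⟨p, hp, hl⟩ := hU.exists_length_eq_condK x []
  rw [← hl]
  by_contra hlt
  exact wellFounded_shortlex.not_lt_min {p : Str | x ∈ U p []} hp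
    (List.Shortlex.of_length_lt (not_le.1 hlt))

/-- A partial recursive function bounds the conditional complexity under each condition for which
its domain happens to be prefix-free; it need not be a prefix machine under other conditions. -/
theorem IsReferenceMachine.exists_condK_le (hU : IsReferenceMachine U) {f : Machine}
    (hf : Partrec₂ f) : ∃ c : ℕ, ∀ s : Str,
      (∀ p q : Str, (f p s).Dom → (f q s).Dom → p <+: q → p = q) →
      ∀ p x : Str, x ∈ f p s → condK U x s ≤ p.length + c := by
  obtain ⟨d, hd⟩ := exists_code_of_partrec hf
  obtain ⟨c, hc⟩ := hU.simulates _ (filterMachine_isPrefix d)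
  refine ⟨c, fun s hs p x hx => ?_⟩
  have hp : (f p s).Dom := Part.dom_iff_mem.2 ⟨x, hx⟩
  obtain ⟨q, hq, hl⟩ := hc p s x (mem_filterMachine hd hx fun r hr hrd => hr.elim
    (fun h => hs r p hrd hp h) fun h => (hs p r hp hrd h).symm)
  exact (condK_le hq).trans hl

/-! ### Relabelling outputs and concatenating programs -/

/-- The inverse of a function `F` as a partial function: search for a preimage. -/
def searchInverse (F : α → Str) (u : Str) : Part α :=
  Nat.rfindOpt fun n => (Encodable.decode (α := α) n).bind fun a => if F a = u then some a else none

theorem searchInverse_partrec {F : α → Str} (hF : Computable F) : Partrec (searchInverse F) := by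
  refine Partrec.rfindOpt (Computable.option_bind (Computable.decode.comp Computable.snd) ?_)
  have h : Computable fun a : (Str × ℕ) × α => decide (F a.2 = a.1.1) :=
    (Primrec.eq (α := Str)).decide.to_comp.comp (hF.comp Computable.snd)
      (Computable.fst.comp Computable.fst)
  exact (Computable.cond h (Computable.option_some.comp Computable.snd)
    (Computable.const none)).of_eq fun a => by by_cases h : F a.2 = a.1.1 <;> simp [h]

theorem mem_searchInverse {F : α → Str} (hF : Function.Injective F) {u : Str} {a : α} :
    a ∈ searchInverse F u ↔ F a = u := by
  have key : ∀ b ∈ searchInverse F u, F b = u := by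
    intro b hb
    obtain ⟨n, hn⟩ := Nat.rfindOpt_spec hb
    simp only [Option.mem_def, Option.bind_eq_some_iff] at hn
    obtain ⟨a', -, h⟩ := hn
    split_ifs at h with h'
    · rwa [← Option.some.inj h]
  refine ⟨key a, fun h => ?_⟩
  have hd : (searchInverse F u).Dom :=
    Nat.rfindOpt_dom.2 ⟨Encodable.encode a, a, by simp [h]⟩
  obtain ⟨b, hb⟩ := Part.dom_iff_mem.1 hd
  rwa [← hF ((key b hb).trans h.symm)]

/-- Replacing one effective description `F a` by another `G a` costs a constant. -/
theorem IsReferenceMachine.exists_condK_comp_le (hU : IsReferenceMachine U) {F G : α → Str}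
    (hF : Computable F) (hinj : Function.Injective F) (hG : Computable G) :
    ∃ c : ℕ, ∀ (a : α) (s : Str), condK U (G a) s ≤ condK U (F a) s + c := by
  obtain ⟨c, hc⟩ := hU.exists_condK_le
    (f := fun p s => (U p s).bind fun u => (searchInverse F u).map G) <|
    Partrec.bind hU.partrec (Partrec.map ((searchInverse_partrec hF).comp Computable.snd)
      (hG.comp Computable.snd).to₂).to₂
  refine ⟨c, fun a s => ?_⟩
  obtain ⟨p, hp, hl⟩ := hU.exists_length_eq_condK (F a) s
  rw [← hl]
  refine hc s (fun p q hp hq => hU.prefixFree s p q hp.1 hq.1) p (G a) ?_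
  exact Part.mem_bind hp (Part.mem_map G ((mem_searchInverse hinj).2 rfl))

/-- The machine that splits its program as `p ++ q` with `p` of length `n`, runs `p` under `s` and
`q` under `cond s p`, and pairs the second output with the first. -/
def concatMachine (U : Machine) (pair cond : Str → Str → Str) (n : ℕ) : Machine := fun w s =>
  (U (w.take n) s).bind fun u => (U (w.drop n) (cond s (w.take n))).map fun v => pair v u

/-- A partial recursive function is the limit of a computable monotone sequence of finite stages. -/
theorem exists_stages {β : Type*} [Primcodable β] {g : α →. β} (hg : Partrec g) :
    ∃ e : α → ℕ → Option β, Computable₂ e ∧ (∀ a, e a 0 = none) ∧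
      (∀ a b t u, t ≤ u → b ∈ e a t → b ∈ e a u) ∧ ∀ a b, b ∈ g a ↔ ∃ t, b ∈ e a t := by
  obtain ⟨c, hc⟩ := Nat.Partrec.Code.exists_code.1 hg
  have hc' : ∀ a, c.eval (Encodable.encode a) = (g a).map Encodable.encode := by
    intro a
    rw [hc]
    simp
  refine ⟨fun a t => (Nat.Partrec.Code.evaln t c (Encodable.encode a)).bind
    (Encodable.decode (α := β)), ?_, fun a => by simp [Nat.Partrec.Code.evaln], ?_, ?_⟩
  · refine Computable.option_bind ?_ (Computable.decode.comp Computable.snd).to₂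
    exact Nat.Partrec.Code.primrec_evaln.to_comp.comp (Computable.pair (Computable.pair
      Computable.snd (Computable.const c)) (Computable.encode.comp Computable.fst))
  · intro a b t u htu hb
    simp only [Option.mem_def, Option.bind_eq_some_iff] at hb ⊢
    obtain ⟨v, hv, hd⟩ := hb
    exact ⟨v, Nat.Partrec.Code.evaln_mono htu hv, hd⟩
  · intro a b
    simp only [Option.mem_def, Option.bind_eq_some_iff]
    constructor
    · intro hb
      have hv : Encodable.encode b ∈ c.eval (Encodable.encode a) := by
        rw [hc']
        exact Part.mem_map _ hb
      obtain ⟨k, hk⟩ := Nat.Partrec.Code.evaln_complete.1 hv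
      exact ⟨k, _, hk, Encodable.encodek b⟩
    · rintro ⟨t, v, hv, hd⟩
      have hv' := Nat.Partrec.Code.evaln_sound hv
      rw [hc'] at hv'
      obtain ⟨b', hb', rfl⟩ := (Part.mem_map_iff _).1 hv'
      rw [Encodable.encodek] at hd
      exact Option.some.inj hd ▸ hb'

/-- A partial recursive function of `a` and `n` can be dovetailed over `n`. -/
theorem exists_dovetail {β : Type*} [Primcodable β] {g : α → ℕ →. β} (hg : Partrec₂ g) :
    ∃ f : α →. β, Partrec f ∧ (∀ a, ∀ b ∈ f a, ∃ n, b ∈ g a n) ∧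
      ∀ a n, (g a n).Dom → (f a).Dom := by
  obtain ⟨e, he, -, -, hlim⟩ := exists_stages hg
  refine ⟨fun a => Nat.rfindOpt fun m => e (a, m.unpair.2) m.unpair.1, ?_, ?_, ?_⟩
  · refine Partrec.rfindOpt (he.comp (Computable.pair Computable.fst ?_) ?_)
    · exact Computable.snd.comp (Computable.unpair.comp Computable.snd)
    · exact Computable.fst.comp (Computable.unpair.comp Computable.snd)
  · intro a b hb
    obtain ⟨m, hm⟩ := Nat.rfindOpt_spec hb
    exact ⟨_, (hlim _ _).2 ⟨_, hm⟩⟩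
  · intro a n hn
    obtain ⟨b, hb⟩ := Part.dom_iff_mem.1 hn
    obtain ⟨t, ht⟩ := (hlim (a, n) b).1 hb
    exact Nat.rfindOpt_dom.2 ⟨Nat.pair t n, b, by simpa using ht⟩

theorem concatMachine_partrec (hU : Partrec₂ U) {pair cond : Str → Str → Str}
    (hpair : Computable₂ pair) (hcond : Computable₂ cond) :
    Partrec₂ fun (a : Str × Str) n => concatMachine U pair cond n a.1 a.2 := by
  have ht : Computable fun a : (Str × Str) × ℕ => a.1.1.take a.2 :=
    (Primrec.list_take.comp Primrec.snd (Primrec.fst.comp Primrec.fst)).to_comp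
  have hd : Computable fun a : (Str × Str) × ℕ => a.1.1.drop a.2 :=
    (Primrec.list_drop.comp Primrec.snd (Primrec.fst.comp Primrec.fst)).to_comp
  have hs : Computable fun a : (Str × Str) × ℕ => a.1.2 := Computable.snd.comp Computable.fst
  refine Partrec.bind (hU.comp ht hs) (Partrec.map ?_ ?_)
  · exact (hU.comp hd (hcond.comp hs ht)).comp Computable.fst
  · exact hpair.comp Computable.snd (Computable.snd.comp Computable.fst)

/-- Self-delimiting programs can be concatenated: the second one may use the first as (part of)
its condition, because the first is recovered from the concatenation. -/
theorem IsReferenceMachine.exists_condK_pair_le (hU : IsReferenceMachine U)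
    {pair cond : Str → Str → Str} (hpair : Computable₂ pair) (hcond : Computable₂ cond) :
    ∃ c : ℕ, ∀ s p u v : Str, u ∈ U p s →
      condK U (pair v u) s ≤ p.length + condK U v (cond s p) + c := by
  obtain ⟨f, hf, hsound, hdom⟩ :=
    exists_dovetail (concatMachine_partrec hU.partrec hpair hcond)
  have hf' : Partrec₂ fun p s => f (p, s) := hf.of_eq fun _ => rfl
  obtain ⟨c, hc⟩ := hU.exists_condK_le hf'
  have split : ∀ (s w x : Str) (n : ℕ), x ∈ concatMachine U pair cond n w s →
      ∃ p q u v, w = p ++ q ∧ u ∈ U p s ∧ v ∈ U q (cond s p) ∧ x = pair v u := by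
    intro s w x n hx
    obtain ⟨u, hu, hx⟩ := Part.mem_bind_iff.1 hx
    obtain ⟨v, hv, rfl⟩ := (Part.mem_map_iff _).1 hx
    exact ⟨_, _, u, v, (List.take_append_drop n w).symm, hu, hv, rfl⟩
  have unique : ∀ (s p q p' q' u v u' v' : Str), u ∈ U p s → u' ∈ U p' s → v ∈ U q (cond s p) →
      v' ∈ U q' (cond s p') → p ++ q <+: p' ++ q' → p = p' ∧ q = q' := by
    intro s p q p' q' u v u' v' hu hu' hv hv' h
    have dom : ∀ {a : Str} {b : Part Str}, a ∈ b → b.Dom := fun h => Part.dom_iff_mem.2 ⟨_, h⟩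
    have e : p = p' := by
      rcases List.prefix_or_prefix_of_prefix ((List.prefix_append p q).trans h)
        (List.prefix_append p' q') with h' | h'
      · exact hU.prefixFree s _ _ (dom hu) (dom hu') h'
      · exact (hU.prefixFree s _ _ (dom hu') (dom hu) h').symm
    subst e
    exact ⟨rfl, hU.prefixFree _ _ _ (dom hv) (dom hv') ((List.prefix_append_right_inj p).1 h)⟩
  refine ⟨c, fun s p u v hu => ?_⟩
  obtain ⟨q, hq, hl⟩ := hU.exists_length_eq_condK v (cond s p)
  rw [← hl, ← List.length_append]
  refine hc s ?_ _ _ ?_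
  · intro w w' hw hw' hww
    obtain ⟨x, hx⟩ := Part.dom_iff_mem.1 hw
    obtain ⟨x', hx'⟩ := Part.dom_iff_mem.1 hw'
    obtain ⟨n, hn⟩ := hsound _ _ hx
    obtain ⟨n', hn'⟩ := hsound _ _ hx'
    obtain ⟨p₁, q₁, u₁, v₁, rfl, hu₁, hv₁, -⟩ := split _ _ _ _ hn
    obtain ⟨p₂, q₂, u₂, v₂, rfl, hu₂, hv₂, -⟩ := split _ _ _ _ hn'
    obtain ⟨rfl, rfl⟩ := unique _ _ _ _ _ _ _ _ _ hu₁ hu₂ hv₁ hv₂ hww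
    rfl
  · have hd : (f (p ++ q, s)).Dom := by
      refine hdom (p ++ q, s) p.length (Part.dom_iff_mem.2 ⟨pair v u, ?_⟩)
      refine Part.mem_bind_iff.2 ⟨u, by simpa using hu, Part.mem_map_iff _ |>.2 ⟨v, ?_, rfl⟩⟩
      simpa using hq
    obtain ⟨x, hx⟩ := Part.dom_iff_mem.1 hd
    obtain ⟨n, hn⟩ := hsound _ _ hx
    obtain ⟨p₁, q₁, u₁, v₁, e, hu₁, hv₁, hxe⟩ := split _ _ _ _ hn
    obtain ⟨rfl, rfl⟩ := unique _ _ _ _ _ _ _ _ _ hu hu₁ hq hv₁ (e ▸ List.prefix_rfl)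
    rwa [Part.mem_unique hu hu₁, Part.mem_unique hq hv₁, ← hxe]

/-! ### Enumerating the values of a family of partial recursive functions -/

theorem iSup_mem_part_of_mem {τ : Type*} {o : Part τ} {x : τ} (hx : x ∈ o) (φ : τ → ℝ≥0∞) :
    ⨆ y ∈ o, φ y = φ x :=
  le_antisymm (iSup₂_le fun _ hy => (Part.mem_unique hy hx) ▸ le_rfl)
    (le_iSup₂_of_le x hx le_rfl)

/-- In a monotone sequence of stages, a value is counted at the one place where it first appears. -/
theorem tsum_first_stage {τ : Type*} {a : ℕ → Option τ} {o : Part τ} (h0 : a 0 = none)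
    (hmono : ∀ b t u, t ≤ u → b ∈ a t → b ∈ a u) (hlim : ∀ b, b ∈ o ↔ ∃ t, b ∈ a t)
    (φ : τ → ℝ≥0∞) :
    ∑' t, (bif (a t).isSome then none else a (t + 1)).elim 0 φ = ⨆ x ∈ o, φ x := by
  by_cases h : ∃ t, (a t).isSome
  · classical
    obtain ⟨t₀, ht₀⟩ : ∃ t₀, Nat.find h = t₀ + 1 := by
      refine Nat.exists_eq_succ_of_ne_zero fun e => ?_
      have := Nat.find_spec h
      rw [e, h0] at this
      simp at this
    have hs := Nat.find_spec h
    rw [ht₀] at hs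
    obtain ⟨x, hx⟩ := Option.isSome_iff_exists.1 hs
    have hn : a t₀ = none := by
      have := Nat.find_min h (m := t₀) (by omega)
      simpa using this
    rw [iSup_mem_part_of_mem ((hlim x).2 ⟨_, hx⟩) φ, tsum_eq_single t₀]
    · simp [hn, hx]
    · intro t ht
      rcases lt_or_gt_of_ne ht with h' | h'
      · have h1 := Nat.find_min h (m := t) (by omega)
        have h2 := Nat.find_min h (m := t + 1) (by omega)
        simp only [Option.not_isSome_iff_eq_none] at h1 h2
        simp [h1, h2]
      · have := hmono x _ _ h' hx
        simp [Option.mem_def.1 this]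
  · have hn : ∀ t, a t = none := by simpa using h
    have ho : ∀ x, x ∉ o := fun x hx => by
      obtain ⟨t, ht⟩ := (hlim x).1 hx
      simp [hn] at ht
    simp [hn, ho]

/-- The values of a family `g s i` of partial recursive functions can be listed by a total
computable function, each index `i` being listed at most once; hence sums over the list are sums
over the indices. -/
theorem exists_enumeration {σ ι τ : Type*} [Primcodable σ] [Primcodable ι] [Primcodable τ]
    {g : σ → ι →. τ} (hg : Partrec₂ g) :
    ∃ e : σ → ℕ → Option τ, Computable₂ e ∧ (∀ s i x, x ∈ g s i → ∃ n, e s n = some x) ∧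
      ∀ s (φ : τ → ℝ≥0∞), ∑' n, (e s n).elim 0 φ = ∑' i, ⨆ x ∈ g s i, φ x := by
  obtain ⟨a, ha, h0, hmono, hlim⟩ := exists_stages hg
  have hlim' : ∀ s i x, x ∈ g s i ↔ ∃ t, x ∈ a (s, i) t := fun s i => hlim (s, i)
  -- A value of `g s i` is listed at the code of `(i, t)` if `t + 1` is the first stage to show it.
  let E : σ → ι × ℕ → Option τ := fun s b =>
    bif (a (s, b.1) b.2).isSome then none else a (s, b.1) (b.2 + 1)
  have hE : Computable₂ E := by
    have h1 : Computable fun b : σ × ι × ℕ => (b.1, b.2.1) :=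
      Computable.fst.pair (Computable.fst.comp Computable.snd)
    have h2 : Computable fun b : σ × ι × ℕ => b.2.2 := Computable.snd.comp Computable.snd
    exact Computable.cond (Primrec.option_isSome.to_comp.comp (ha.comp h1 h2))
      (Computable.const none) (ha.comp h1 (Computable.succ.comp h2))
  have hsum : ∀ s i (φ : τ → ℝ≥0∞), ∑' t, (E s (i, t)).elim 0 φ = ⨆ x ∈ g s i, φ x :=
    fun s i φ => tsum_first_stage (h0 _) (hmono _) (hlim' s i) φ
  refine ⟨fun s n => (Encodable.decode₂ (ι × ℕ) n).bind (E s), ?_, ?_, ?_⟩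
  · exact Computable.option_bind (Primrec.decode₂.to_comp.comp Computable.snd)
      (hE.comp (Computable.fst.comp Computable.fst) Computable.snd).to₂
  · intro s i x hx
    by_contra hne
    have hz : ∀ t, ¬ E s (i, t) = some x := fun t ht =>
      hne ⟨Encodable.encode (i, t), by
        beta_reduce
        rw [Encodable.decode₂_encode, Option.bind_some, ht]⟩
    have := hsum s i (fun y => Set.indicator {x} (fun _ => 1) y)
    rw [iSup_mem_part_of_mem hx, ENNReal.tsum_eq_zero.2] at this
    · simp at this
    · intro t
      cases h : E s (i, t) with
      | none => rfl
      | some y =>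
        have : y ≠ x := fun e => hz t (e ▸ h)
        simp [this]
  · intro s φ
    simp only [← hsum]
    rw [← ENNReal.tsum_prod (f := fun i t => (E s (i, t)).elim 0 φ),
      ← Function.Injective.tsum_eq (Encodable.encode_injective (α := ι × ℕ))]
    · simp [Encodable.decode₂_encode]
    · intro n hn
      rw [← Encodable.decode₂_ne_none_iff]
      intro h
      simp [h] at hn

/-! ### Dyadic partial sums -/

/-- Add `2⁻ᵏ` to a dyadic rational; `(a, e)` stands for `a / 2 ^ e`. -/
def dyadicStep (d : ℕ × ℕ) (o : Option ℕ) : ℕ × ℕ :=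
  o.elim d fun k => (d.1 * 2 ^ k + 2 ^ d.2, d.2 + k)

/-- The sum of `2⁻ᵏ` over the values `k` of `r` at arguments below `n`, as a pair `(a, e)` that
stands for `a / 2 ^ e`. -/
def dyadicSum (r : ℕ → Option ℕ) (n : ℕ) : ℕ × ℕ :=
  Nat.rec (0, 0) (fun m d => dyadicStep d (r m)) n

/-- The real number that a pair `(a, e)` stands for. -/
noncomputable def dyadicVal (d : ℕ × ℕ) : ℝ := d.1 / 2 ^ d.2

theorem computable_two_pow : Computable fun n : ℕ => 2 ^ n := by
  have : Primrec fun n : ℕ => Nat.rec (motive := fun _ => ℕ) 1 (fun _ m => 2 * m) n :=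
    Primrec.nat_rec₁ 1 (Primrec.nat_mul.comp (Primrec.const 2) Primrec.snd).to₂
  refine this.to_comp.of_eq fun n => ?_
  induction n with
  | zero => rfl
  | succ n ih => rw [pow_succ', ← ih]

theorem computable_add {f g : α → ℕ} (hf : Computable f) (hg : Computable g) :
    Computable fun a => f a + g a := Primrec.nat_add.to_comp.comp hf hg

theorem computable_mul {f g : α → ℕ} (hf : Computable f) (hg : Computable g) :
    Computable fun a => f a * g a := Primrec.nat_mul.to_comp.comp hf hg

theorem computable_dyadicSum {r : α → ℕ → Option ℕ} (hr : Computable₂ r) :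
    Computable₂ fun a n => dyadicSum (r a) n := by
  have hstep : Computable₂ dyadicStep := by
    refine (Computable.option_casesOn (o := fun b : (ℕ × ℕ) × Option ℕ => b.2) (f := fun b => b.1)
      (g := fun b k => (b.1.1 * 2 ^ k + 2 ^ b.1.2, b.1.2 + k)) Computable.snd Computable.fst
      ?_).of_eq fun b => by rcases b with ⟨d, _ | k⟩ <;> rfl
    have h1 : Computable fun b : ((ℕ × ℕ) × Option ℕ) × ℕ => b.1.1.1 :=
      Computable.fst.comp (Computable.fst.comp Computable.fst)
    have h2 : Computable fun b : ((ℕ × ℕ) × Option ℕ) × ℕ => b.1.1.2 :=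
      Computable.snd.comp (Computable.fst.comp Computable.fst)
    exact Computable.pair (computable_add
      (computable_mul h1 (computable_two_pow.comp Computable.snd))
      (computable_two_pow.comp h2)) (computable_add h2 Computable.snd)
  have h : Computable fun b : (α × ℕ) × ℕ × ℕ × ℕ => dyadicStep b.2.2 (r b.1.1 b.2.1) :=
    hstep.comp (Computable.snd.comp Computable.snd)
      (hr.comp (Computable.fst.comp Computable.fst) (Computable.fst.comp Computable.snd))
  exact Computable.nat_rec Computable.snd (Computable.const (0, 0)) h.to₂

theorem dyadicVal_dyadicSum_succ (r : ℕ → Option ℕ) (n : ℕ) :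
    dyadicVal (dyadicSum r (n + 1)) =
      dyadicVal (dyadicSum r n) + (r n).elim 0 fun k => (2⁻¹ : ℝ) ^ k := by
  change dyadicVal (dyadicStep (dyadicSum r n) (r n)) = _
  cases r n with
  | none => simp [dyadicStep]
  | some k =>
    simp only [dyadicStep, dyadicVal, Option.elim_some]
    push_cast
    rw [pow_add, inv_pow]
    field_simp

theorem dyadicVal_dyadicSum_mono (r : ℕ → Option ℕ) :
    Monotone fun n => dyadicVal (dyadicSum r n) := by
  refine monotone_nat_of_le_succ fun n => ?_
  rw [dyadicVal_dyadicSum_succ]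
  cases r n with
  | none => simp
  | some k => simp

theorem ofReal_dyadicVal_dyadicSum (r : ℕ → Option ℕ) (n : ℕ) :
    ENNReal.ofReal (dyadicVal (dyadicSum r n)) =
      ∑ m ∈ Finset.range n, (r m).elim 0 fun k => (2⁻¹ : ℝ≥0∞) ^ k := by
  induction n with
  | zero => simp [dyadicSum, dyadicVal]
  | succ n ih =>
    rw [dyadicVal_dyadicSum_succ, Finset.sum_range_succ, ← ih, ENNReal.ofReal_add]
    · congr 1
      cases r n with
      | none => simp
      | some k =>
        rw [Option.elim_some, Option.elim_some, ENNReal.ofReal_pow (by positivity),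
          ENNReal.ofReal_inv_of_pos two_pos, ENNReal.ofReal_ofNat]
    · unfold dyadicVal
      positivity
    · cases r n with
      | none => simp
      | some k => simp

/-! ### Binary strings as dyadic intervals -/

/-- The natural number with the given binary digits, the most significant one first. The string
`q` is identified with the interval `[v / 2 ^ l, (v + 1) / 2 ^ l)`, where `v` is its binary value
and `l` its length. -/
def binaryValue (q : Str) : ℕ := q.foldl (fun a b => 2 * a + b.toNat) 0

theorem computable_binaryValue : Computable binaryValue := by
  refine (Primrec.list_foldl (f := fun q : Str => q) (g := fun _ => 0)
    (h := fun _ b => 2 * b.1 + b.2.toNat) Primrec.id (Primrec.const 0) ?_).to_comp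
  refine Primrec.nat_add.comp (Primrec.nat_mul.comp (Primrec.const 2)
    (Primrec.fst.comp Primrec.snd)) ?_
  exact (Primrec.dom_bool Bool.toNat).comp (Primrec.snd.comp Primrec.snd)

theorem binaryValue_concat (q : Str) (b : Bool) :
    binaryValue (q ++ [b]) = 2 * binaryValue q + b.toNat := by
  simp [binaryValue]

theorem binaryValue_append (q r : Str) : binaryValue q * 2 ^ r.length ≤ binaryValue (q ++ r) ∧
    binaryValue (q ++ r) + 1 ≤ (binaryValue q + 1) * 2 ^ r.length := by
  induction r using List.reverseRecOn with
  | nil => simp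
  | append_singleton r b ih =>
    rw [← List.append_assoc, binaryValue_concat, List.length_append, List.length_singleton,
      pow_succ]
    have := b.toNat_le
    constructor <;> linarith [ih.1, ih.2]

theorem exists_binaryValue_eq {l v : ℕ} (h : v < 2 ^ l) :
    ∃ q : Str, q.length = l ∧ binaryValue q = v := by
  induction l generalizing v with
  | zero => exact ⟨[], rfl, by simp [binaryValue]; omega⟩
  | succ l ih =>
    obtain ⟨q, hq, hv⟩ := ih (v := v / 2) (by rw [pow_succ] at h; omega)
    refine ⟨q ++ [decide (v % 2 = 1)], by simp [hq], ?_⟩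
    rw [binaryValue_concat, hv]
    rcases Nat.mod_two_eq_zero_or_one v with h' | h' <;> simp [h'] <;> omega

theorem binaryValue_div_mono {q q' : Str} (h : q <+: q') :
    (binaryValue q : ℝ) / 2 ^ q.length ≤ binaryValue q' / 2 ^ q'.length ∧
      ((binaryValue q' : ℝ) + 1) / 2 ^ q'.length ≤ (binaryValue q + 1) / 2 ^ q.length := by
  obtain ⟨r, rfl⟩ := h
  obtain ⟨h1, h2⟩ := binaryValue_append q r
  have h1' : (binaryValue q : ℝ) * 2 ^ r.length ≤ binaryValue (q ++ r) := by exact_mod_cast h1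
  have h2' : (binaryValue (q ++ r) : ℝ) + 1 ≤ (binaryValue q + 1) * 2 ^ r.length := by
    exact_mod_cast h2
  rw [List.length_append, pow_add]
  constructor
  · rw [div_le_div_iff₀ (by positivity) (by positivity)]
    nlinarith [pow_pos (two_pos (α := ℝ)) q.length]
  · rw [div_le_div_iff₀ (by positivity) (by positivity)]
    nlinarith [pow_pos (two_pos (α := ℝ)) q.length]

/-! ### Effective coding of requests -/

/-- The request `r n = some k` receives the interval between the partial sums of `2⁻ᵏ` before and
after it; `q` is admissible for it if `q` has length `k + 1` and its left end point lies in the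
first half of that interval, which forces the interval of `q` into it. -/
def Admissible (r : ℕ → Option ℕ) (n k : ℕ) (q : Str) : Prop :=
  q.length = k + 1 ∧
    (dyadicSum r n).1 * 2 ^ (k + 1) ≤ binaryValue q * 2 ^ (dyadicSum r n).2 ∧
    binaryValue q * 2 ^ (dyadicSum r n).2 <
      (dyadicSum r n).1 * 2 ^ (k + 1) + 2 ^ (dyadicSum r n).2

instance (r : ℕ → Option ℕ) (n k : ℕ) (q : Str) : Decidable (Admissible r n k q) :=
  inferInstanceAs (Decidable (_ ∧ _ ∧ _))

section Admissible

variable {r : ℕ → Option ℕ} {n m k k' : ℕ} {q q' : Str}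

theorem Admissible.mem_interval (h : Admissible r n k q) (hn : r n = some k) :
    dyadicVal (dyadicSum r n) ≤ binaryValue q / 2 ^ q.length ∧
      ((binaryValue q : ℝ) + 1) / 2 ^ q.length ≤ dyadicVal (dyadicSum r (n + 1)) := by
  obtain ⟨hl, h1, h2⟩ := h
  rw [dyadicVal_dyadicSum_succ, hn, hl]
  simp only [dyadicVal, Option.elim_some]
  generalize dyadicSum r n = d at *
  have h1' : (d.1 : ℝ) * 2 ^ (k + 1) ≤ binaryValue q * 2 ^ d.2 := by exact_mod_cast h1
  have h2' : (binaryValue q : ℝ) * 2 ^ d.2 < d.1 * 2 ^ (k + 1) + 2 ^ d.2 := by exact_mod_cast h2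
  have hd : (0 : ℝ) < 2 ^ d.2 := by positivity
  have hk : (0 : ℝ) < 2 ^ k := by positivity
  constructor
  · rwa [div_le_div_iff₀ hd (by positivity)]
  · rw [inv_pow, div_add' _ _ _ hd.ne', div_le_div_iff₀ (by positivity) hd]
    rw [pow_succ] at *
    have : (2 ^ k : ℝ)⁻¹ * 2 ^ d.2 * (2 ^ k * 2) = 2 * 2 ^ d.2 := by field_simp
    nlinarith

/-- Words admissible for different requests are incomparable. -/
theorem Admissible.index_eq_of_prefix (h : Admissible r n k q) (hn : r n = some k)
    (h' : Admissible r m k' q') (hm : r m = some k') (hq : q <+: q') : n = m := by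
  obtain ⟨h1, h2⟩ := h.mem_interval hn
  obtain ⟨h1', h2'⟩ := h'.mem_interval hm
  obtain ⟨i1, i2⟩ := binaryValue_div_mono hq
  have hlt : (binaryValue q' : ℝ) / 2 ^ q'.length < (binaryValue q' + 1) / 2 ^ q'.length := by
    gcongr
    linarith
  rcases lt_trichotomy n m with hnm | hnm | hnm
  · have := dyadicVal_dyadicSum_mono r (show n + 1 ≤ m from hnm)
    simp only at this
    linarith
  · exact hnm
  · have := dyadicVal_dyadicSum_mono r (show m + 1 ≤ n from hnm)
    simp only at this
    linarith

theorem exists_admissible (hn : r n = some k) (hle : dyadicVal (dyadicSum r (n + 1)) ≤ 1) :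
    ∃ q, Admissible r n k q := by
  rw [dyadicVal_dyadicSum_succ, hn] at hle
  simp only [dyadicVal, Option.elim_some] at hle
  unfold Admissible
  generalize dyadicSum r n = d at *
  have hd : 0 < 2 ^ d.2 := by positivity
  have hle' : d.1 * 2 ^ (k + 1) + 2 * 2 ^ d.2 ≤ 2 ^ (k + 1) * 2 ^ d.2 := by
    have hk : (0 : ℝ) < 2 ^ k := by positivity
    have hd' : (0 : ℝ) < 2 ^ d.2 := by positivity
    have h := mul_le_mul_of_nonneg_right hle (mul_pos hd' hk).le
    have e : (d.1 / 2 ^ d.2 + 2⁻¹ ^ k : ℝ) * (2 ^ d.2 * 2 ^ k) = d.1 * 2 ^ k + 2 ^ d.2 := by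
      rw [inv_pow]
      field_simp
    rw [e, one_mul] at h
    have h' : d.1 * 2 ^ k + 2 ^ d.2 ≤ 2 ^ d.2 * 2 ^ k := by exact_mod_cast h
    rw [pow_succ]
    nlinarith
  -- The left end point is the start of the interval, rounded up to a multiple of `2 ^ -(k + 1)`.
  set v := (d.1 * 2 ^ (k + 1) + (2 ^ d.2 - 1)) / 2 ^ d.2 with hv
  have hdm := Nat.div_add_mod (d.1 * 2 ^ (k + 1) + (2 ^ d.2 - 1)) (2 ^ d.2)
  have hml := Nat.mod_lt (d.1 * 2 ^ (k + 1) + (2 ^ d.2 - 1)) hd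
  rw [← hv, mul_comm] at hdm
  obtain ⟨q, hq, hqv⟩ := exists_binaryValue_eq (l := k + 1) (v := v)
    (lt_of_mul_lt_mul_right (a := 2 ^ d.2) (by omega) (Nat.zero_le _))
  exact ⟨q, hq, by rw [hqv]; omega, by rw [hqv]; omega⟩

end Admissible

/-- The machine that looks for a request `(k, x)` in the list `e s` for which its program is
admissible, and outputs `x`. -/
def requestMachine (e : Str → ℕ → Option (ℕ × Str)) : Machine := fun q s =>
  Nat.rfindOpt fun n => (e s n).bind fun a =>
    bif decide (Admissible (fun m => (e s m).map Prod.fst) n a.1 q) then some a.2 else none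

theorem requestMachine_partrec {e : Str → ℕ → Option (ℕ × Str)} (he : Computable₂ e) :
    Partrec₂ (requestMachine e) := by
  refine Partrec.rfindOpt (Computable.option_bind
    (he.comp (Computable.snd.comp Computable.fst) Computable.snd) ?_)
  refine Computable.cond ?_ (Computable.option_some.comp (Computable.snd.comp Computable.snd))
    (Computable.const none)
  have hr : Computable₂ fun (s : Str) (m : ℕ) => (e s m).map Prod.fst :=
    Computable.option_map he (Computable.fst.comp Computable.snd).to₂
  have hq : Computable fun b : ((Str × Str) × ℕ) × (ℕ × Str) => b.1.1.1 :=
    Computable.fst.comp (Computable.fst.comp Computable.fst)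
  have hk : Computable fun b : ((Str × Str) × ℕ) × (ℕ × Str) => b.2.1 + 1 :=
    Computable.succ.comp (Computable.fst.comp Computable.snd)
  have hd : Computable fun b : ((Str × Str) × ℕ) × (ℕ × Str) =>
      dyadicSum (fun m => (e b.1.1.2 m).map Prod.fst) b.1.2 :=
    (computable_dyadicSum hr).comp (Computable.snd.comp (Computable.fst.comp Computable.fst))
      (Computable.snd.comp Computable.fst)
  have hp := computable_two_pow.comp (Computable.snd.comp hd)
  have hx := computable_mul (Computable.fst.comp hd) (computable_two_pow.comp hk)
  have hv := computable_mul (computable_binaryValue.comp hq) hp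
  have c1 := (Primrec.eq (α := ℕ)).decide.to_comp.comp (Computable.list_length.comp hq) hk
  have c2 := Primrec.nat_le.decide.to_comp.comp hx hv
  have c3 := Primrec.nat_lt.decide.to_comp.comp hv (computable_add hx hp)
  refine (Primrec.and.to_comp.comp c1 (Primrec.and.to_comp.comp c2 c3)).of_eq fun b => ?_
  rw [Bool.eq_iff_iff]
  simp only [Bool.and_eq_true, decide_eq_true_eq]
  rfl

theorem exists_of_mem_requestMachine {e : Str → ℕ → Option (ℕ × Str)} {q s x : Str}
    (h : x ∈ requestMachine e q s) : ∃ n k, e s n = some (k, x) ∧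
      Admissible (fun m => (e s m).map Prod.fst) n k q := by
  obtain ⟨n, hn⟩ := Nat.rfindOpt_spec h
  simp only [Option.mem_def, Option.bind_eq_some_iff] at hn
  obtain ⟨⟨k, x'⟩, he, hx⟩ := hn
  by_cases hA : Admissible (fun m => (e s m).map Prod.fst) n k q
  · simp only [hA, decide_true, cond_true, Option.some.injEq] at hx
    exact ⟨n, k, hx ▸ he, hA⟩
  · simp [hA] at hx

/-- The effective converse of Kraft's inequality: an enumerable family of requests `(k, x)` of total
weight at most one is served by programs of length `k + O(1)`. -/
theorem IsReferenceMachine.exists_condK_le_of_requests (hU : IsReferenceMachine U) {ι : Type*}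
    [Primcodable ι] {g : Str → ι →. ℕ × Str} (hg : Partrec₂ g) :
    ∃ c : ℕ, ∀ s : Str, ∑' i, ⨆ a ∈ g s i, (2⁻¹ : ℝ≥0∞) ^ a.1 ≤ 1 →
      ∀ i k x, (k, x) ∈ g s i → condK U x s ≤ k + c := by
  obtain ⟨e, he, hall, hsum⟩ := exists_enumeration hg
  obtain ⟨c, hc⟩ := hU.exists_condK_le (requestMachine_partrec he)
  refine ⟨c + 1, fun s hs i k x hx => ?_⟩
  set r : ℕ → Option ℕ := fun m => (e s m).map Prod.fst with hr
  have hone : ∀ n, dyadicVal (dyadicSum r n) ≤ 1 := by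
    intro n
    rw [← ENNReal.ofReal_le_one, ofReal_dyadicVal_dyadicSum]
    refine (ENNReal.sum_le_tsum _).trans (le_trans (le_of_eq ?_) hs)
    rw [← hsum s fun a => (2⁻¹ : ℝ≥0∞) ^ a.1]
    refine tsum_congr fun m => ?_
    simp only [hr]
    cases e s m <;> rfl
  have unique : ∀ p q y z, y ∈ requestMachine e p s → z ∈ requestMachine e q s → p <+: q →
      p = q ∧ ∃ n k, e s n = some (k, y) ∧ e s n = some (k, z) := by
    intro p q y z hy hz hpq
    obtain ⟨n, k, hn, hA⟩ := exists_of_mem_requestMachine hy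
    obtain ⟨n', k', hn', hA'⟩ := exists_of_mem_requestMachine hz
    obtain rfl := hA.index_eq_of_prefix (by simp [hn]) hA' (by simp [hn']) hpq
    obtain rfl : k = k' := by
      rw [hn] at hn'
      exact congrArg Prod.fst (Option.some.inj hn')
    exact ⟨hpq.eq_of_length (hA.1.trans hA'.1.symm), n, k, hn, hn'⟩
  obtain ⟨n, hn⟩ := hall s i _ hx
  have hrn : r n = some k := by simp [hr, hn]
  obtain ⟨q, hq⟩ := exists_admissible hrn (hone _)
  have hd : (requestMachine e q s).Dom := by
    refine Nat.rfindOpt_dom.2 ⟨n, x, ?_⟩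
    simp only [hn, Option.bind_some, Option.mem_def]
    rw [← hr]
    simp [hq]
  have hxq : x ∈ requestMachine e q s := by
    obtain ⟨y, hy⟩ := Part.dom_iff_mem.1 hd
    obtain ⟨m, k', hm, hA⟩ := exists_of_mem_requestMachine hy
    obtain rfl := hq.index_eq_of_prefix hrn hA
      (show r m = some k' by simp [hr, hm]) List.prefix_rfl
    rw [hn] at hm
    obtain ⟨-, rfl⟩ := Prod.mk.inj (Option.some.inj hm)
    exact hy
  have := hc s (fun p q hp hq hpq => by
    obtain ⟨y, hy⟩ := Part.dom_iff_mem.1 hp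
    obtain ⟨z, hz⟩ := Part.dom_iff_mem.1 hq
    exact (unique p q y z hy hz hpq).1) q x hxq
  rw [hq.1] at this
  omega

/-! ### The coding theorem -/

/-- The halves of the powers `2⁻ᵏ ≤ P` of one half add up to at most the largest of these powers. -/
theorem tsum_pow_succ_of_le (P : ℝ≥0∞) :
    ∑' k : ℕ, (⨆ _ : (2⁻¹ : ℝ≥0∞) ^ k ≤ P, (2⁻¹ : ℝ≥0∞) ^ (k + 1)) ≤ P := by
  classical
  by_cases h : ∃ k : ℕ, (2⁻¹ : ℝ≥0∞) ^ k ≤ P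
  · obtain ⟨k₀, h₀, hmin⟩ : ∃ k₀ : ℕ, (2⁻¹ : ℝ≥0∞) ^ k₀ ≤ P ∧
        ∀ k < k₀, ¬ (2⁻¹ : ℝ≥0∞) ^ k ≤ P := ⟨Nat.find h, Nat.find_spec h, fun k => Nat.find_min h⟩
    rw [← Summable.sum_add_tsum_nat_add' (k := k₀) ENNReal.summable,
      Finset.sum_eq_zero fun k hk => by simp [hmin k (Finset.mem_range.1 hk)], zero_add]
    calc ∑' k : ℕ, (⨆ _ : (2⁻¹ : ℝ≥0∞) ^ (k + k₀) ≤ P, (2⁻¹ : ℝ≥0∞) ^ (k + k₀ + 1))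
        ≤ ∑' k : ℕ, (2⁻¹ : ℝ≥0∞) ^ k * (2⁻¹ ^ (k₀ + 1)) := ENNReal.tsum_le_tsum fun k =>
          iSup_le fun _ => by rw [← pow_add, add_assoc]
      _ = 2⁻¹ ^ k₀ := by
          rw [ENNReal.tsum_mul_right, ENNReal.tsum_geometric, ENNReal.one_sub_inv_two, inv_inv,
            pow_succ, mul_comm, mul_assoc, ENNReal.inv_mul_cancel (by simp) (by simp), mul_one]
      _ ≤ P := h₀
  · push Not at h
    simp [fun k => not_le.2 (h k)]

/-- Whether the sum of `2⁻ᵏ` over the values `k` of a family reaches `2⁻ᵐ` is semidecidable, up to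
the boundary case. -/
theorem exists_partrec_le_tsum {σ ι : Type*} [Primcodable σ] [Primcodable ι] {g : σ → ι →. ℕ}
    (hg : Partrec₂ g) : ∃ f : σ × ℕ →. ℕ, Partrec f ∧
      (∀ s m, (f (s, m)).Dom → (2⁻¹ : ℝ≥0∞) ^ m ≤ ∑' i, ⨆ k ∈ g s i, (2⁻¹ : ℝ≥0∞) ^ k) ∧
      ∀ s m, (2⁻¹ : ℝ≥0∞) ^ m < ∑' i, ⨆ k ∈ g s i, (2⁻¹ : ℝ≥0∞) ^ k → (f (s, m)).Dom := by
  obtain ⟨e, he, -, hsum⟩ := exists_enumeration hg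
  have key : ∀ s m n, 2 ^ (dyadicSum (e s) n).2 ≤ (dyadicSum (e s) n).1 * 2 ^ m ↔
      (2⁻¹ : ℝ≥0∞) ^ m ≤ ∑ j ∈ Finset.range n, (e s j).elim 0 fun k => (2⁻¹ : ℝ≥0∞) ^ k := by
    intro s m n
    rw [← ofReal_dyadicVal_dyadicSum]
    generalize dyadicSum (e s) n = d
    have hm : (2⁻¹ : ℝ≥0∞) ^ m = ENNReal.ofReal (1 / 2 ^ m) := by
      rw [one_div, ← inv_pow, ENNReal.ofReal_pow (by positivity),
        ENNReal.ofReal_inv_of_pos two_pos, ENNReal.ofReal_ofNat]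
    have hd : 0 ≤ dyadicVal d := by
      unfold dyadicVal
      positivity
    rw [hm, ENNReal.ofReal_le_ofReal_iff hd, dyadicVal, div_le_div_iff₀ (by positivity)
      (by positivity), one_mul]
    exact_mod_cast Iff.rfl
  refine ⟨fun a => Nat.rfindOpt fun n => bif decide (2 ^ (dyadicSum (e a.1) n).2 ≤
    (dyadicSum (e a.1) n).1 * 2 ^ a.2) then some 0 else none, ?_, ?_, ?_⟩
  · refine Partrec.rfindOpt (Computable.cond ?_ (Computable.const _) (Computable.const _))
    have hd : Computable fun b : (σ × ℕ) × ℕ => dyadicSum (e b.1.1) b.2 :=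
      (computable_dyadicSum he).comp (Computable.fst.comp Computable.fst) Computable.snd
    exact Primrec.nat_le.decide.to_comp.comp (computable_two_pow.comp (Computable.snd.comp hd))
      (computable_mul (Computable.fst.comp hd)
        (computable_two_pow.comp (Computable.snd.comp Computable.fst)))
  · intro s m h
    obtain ⟨n, _, hn⟩ := Nat.rfindOpt_dom.1 h
    by_cases hle : 2 ^ (dyadicSum (e s) n).2 ≤ (dyadicSum (e s) n).1 * 2 ^ m
    · exact ((key s m n).1 hle).trans ((ENNReal.sum_le_tsum _).trans_eq (hsum s _))
    · simp [hle] at hn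
  · intro s m h
    rw [← hsum s, ENNReal.tsum_eq_iSup_nat] at h
    obtain ⟨n, hn⟩ := lt_iSup_iff.1 h
    refine Nat.rfindOpt_dom.2 ⟨n, 0, ?_⟩
    simp [(key s m n).2 hn.le]

/-- The coding theorem: a lower semicomputable semimeasure on strings is bounded by `2 ^ -K` up to a
constant factor. The semimeasure is given as a sum of dyadic weights listed by a family `g` of
partial recursive functions. -/
theorem IsReferenceMachine.exists_tsum_mul_two_pow_condK_le (hU : IsReferenceMachine U) {ι : Type*}
    [Primcodable ι] {g : Str → ι →. ℕ} (hg : Partrec₂ g)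
    (h1 : ∑' b, ∑' i, ⨆ k ∈ g b i, (2⁻¹ : ℝ≥0∞) ^ k ≤ 1) :
    ∃ c : ℕ, ∀ b, (∑' i, ⨆ k ∈ g b i, (2⁻¹ : ℝ≥0∞) ^ k) * 2 ^ condK U b [] ≤ 2 ^ c := by
  set P : Str → ℝ≥0∞ := fun b => ∑' i, ⨆ k ∈ g b i, (2⁻¹ : ℝ≥0∞) ^ k with hP
  obtain ⟨f, hf, hle, hlt⟩ := exists_partrec_le_tsum hg
  -- A program of length `m + 1` is requested for `b` whenever `2⁻ᵐ < P b`, and never unless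
  -- `2⁻ᵐ ≤ P b`; the requests for `b` thus form a geometric series of sum at most `P b`.
  obtain ⟨c, hc⟩ := hU.exists_condK_le_of_requests (ι := Str × ℕ)
    (g := fun _ a => (f a).map fun _ => (a.2 + 1, a.1)) <|
      Partrec.map (hf.comp Computable.snd) (Computable.pair
        (Computable.succ.comp (Computable.snd.comp (Computable.snd.comp Computable.fst)))
        (Computable.fst.comp (Computable.snd.comp Computable.fst))).to₂
  have hsum : ∑' a : Str × ℕ, ⨆ y ∈ (f a).map fun _ => (a.2 + 1, a.1), (2⁻¹ : ℝ≥0∞) ^ y.1 ≤ 1 := by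
    refine le_trans ?_ h1
    calc ∑' a : Str × ℕ, ⨆ y ∈ (f a).map fun _ => (a.2 + 1, a.1), (2⁻¹ : ℝ≥0∞) ^ y.1
        ≤ ∑' a : Str × ℕ, ⨆ _ : (2⁻¹ : ℝ≥0∞) ^ a.2 ≤ P a.1, (2⁻¹ : ℝ≥0∞) ^ (a.2 + 1) := by
          refine ENNReal.tsum_le_tsum fun a => iSup₂_le fun y hy => ?_
          obtain ⟨z, hz, rfl⟩ := (Part.mem_map_iff _).1 hy
          exact le_iSup_of_le (hle a.1 a.2 (Part.dom_iff_mem.2 ⟨z, hz⟩)) le_rfl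
      _ = ∑' b, ∑' m : ℕ, ⨆ _ : (2⁻¹ : ℝ≥0∞) ^ m ≤ P b, (2⁻¹ : ℝ≥0∞) ^ (m + 1) :=
          ENNReal.tsum_prod (f := fun b m => ⨆ _ : (2⁻¹ : ℝ≥0∞) ^ m ≤ P b, (2⁻¹ : ℝ≥0∞) ^ (m + 1))
      _ ≤ ∑' b, P b := ENNReal.tsum_le_tsum fun b => tsum_pow_succ_of_le (P b)
  have hK : ∀ b m, (2⁻¹ : ℝ≥0∞) ^ m < P b → condK U b [] ≤ m + 1 + c := by
    intro b m h
    obtain ⟨z, hz⟩ := Part.dom_iff_mem.1 (hlt b m h)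
    exact hc [] hsum (b, m) (m + 1) b (Part.mem_map _ hz)
  refine ⟨c + 2, fun b => ?_⟩
  change P b * _ ≤ _
  rcases le_or_gt (condK U b []) (c + 2) with h | h
  · calc P b * 2 ^ condK U b [] ≤ 1 * 2 ^ (c + 2) :=
          mul_le_mul' ((ENNReal.le_tsum b).trans h1) (pow_le_pow_right₀ (by norm_num) h)
      _ = 2 ^ (c + 2) := one_mul _
  · obtain ⟨m, hm⟩ := Nat.exists_eq_add_of_lt h
    have hle : P b ≤ 2⁻¹ ^ (m + 1) := by
      by_contra hgt
      have := hK b (m + 1) (not_le.1 hgt)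
      omega
    calc P b * 2 ^ condK U b [] ≤ 2⁻¹ ^ (m + 1) * 2 ^ ((m + 1) + (c + 2)) :=
          mul_le_mul' hle (le_of_eq (by rw [hm]; ring_nf))
      _ = 2 ^ (c + 2) := by
          rw [pow_add 2 (m + 1), ← mul_assoc, ← mul_pow,
            ENNReal.inv_mul_cancel (by simp) (by simp), one_pow, one_mul]

/-! ### Additivity of complexity -/

/-- The partial function that yields `a` whenever the program `p` outputs `pair a b`. -/
def firstComponent (U : Machine) (pair : Str → Str → Str) (b p : Str) : Part Str :=
  (U p []).bind fun v => (searchInverse (fun a : Str × Str => pair a.1 a.2) v).bind fun a =>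
    ((bif decide (a.2 = b) then some a.1 else none : Option Str) : Part Str)

theorem firstComponent_partrec (hU : Partrec₂ U) {pair : Str → Str → Str}
    (hpair : Computable₂ pair) : Partrec₂ (firstComponent U pair) := by
  refine Partrec.bind (hU.comp Computable.snd (Computable.const [])) (Partrec.bind
    ((searchInverse_partrec hpair).comp Computable.snd) (Computable.ofOption (Computable.cond ?_
      (Computable.option_some.comp (Computable.fst.comp Computable.snd)) (Computable.const _))))
  exact (Primrec.eq (α := Str)).decide.to_comp.comp (Computable.snd.comp Computable.snd)
    (Computable.fst.comp (Computable.fst.comp Computable.fst))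

theorem IsPairing.injective_uncurry {pair : Str → Str → Str} (hpair : IsPairing pair) :
    Function.Injective fun a : Str × Str => pair a.1 a.2 := fun _ _ h =>
  Prod.ext (hpair.injective h).1 (hpair.injective h).2

theorem mem_firstComponent {pair : Str → Str → Str} (hpair : IsPairing pair) {a b p : Str} :
    a ∈ firstComponent U pair b p ↔ pair a b ∈ U p [] := by
  simp only [firstComponent, Part.mem_bind_iff, mem_searchInverse hpair.injective_uncurry]
  constructor
  · rintro ⟨v, hv, ⟨a', b'⟩, rfl, h⟩
    by_cases hb : b' = b
    · simp only [hb, decide_true, cond_true, Part.coe_some, Part.mem_some_iff] at h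
      rwa [h, ← hb]
    · simp [hb] at h
  · intro h
    exact ⟨_, h, (a, b), rfl, by simp⟩

/-- The hard half of the additivity of prefix complexity: `K(b) + K(a | b*) ≤ K(a, b) + O(1)`. By
the coding theorem the programs for pairs `⟨·, b⟩` have total weight at most `2 ^ (c - K(b))`, so
that, once `b*` and hence `K(b)` is known, all of them can be shortened by `K(b) - c` bits. -/
theorem IsReferenceMachine.exists_condK_shortestProgram_add_le (hU : IsReferenceMachine U)
    {pair : Str → Str → Str} (hpair : IsPairing pair) : ∃ c : ℕ, ∀ a b : Str,
      condK U a (shortestProgram U hU b) + condK U b [] ≤ condK U (pair a b) [] + c := by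
  have hfc := firstComponent_partrec hU.partrec hpair.computable
  set W : Str → Str → ℝ≥0∞ := fun b p =>
    ⨆ k ∈ (firstComponent U pair b p).map fun _ => p.length, (2⁻¹ : ℝ≥0∞) ^ k with hW
  have hWmem : ∀ {a b p}, a ∈ firstComponent U pair b p → W b p = 2⁻¹ ^ p.length :=
    fun h => iSup_mem_part_of_mem (Part.mem_map (fun _ => _) h) _
  have hWzero : ∀ {b p}, (∀ a, a ∉ firstComponent U pair b p) → W b p = 0 := by
    intro b p h
    refine le_antisymm (iSup₂_le fun k hk => ?_) bot_le
    obtain ⟨a, ha, -⟩ := (Part.mem_map_iff _).1 hk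
    exact absurd ha (h a)
  have hsum : ∑' b, ∑' p, W b p ≤ 1 := by
    rw [ENNReal.tsum_comm]
    refine le_trans (ENNReal.tsum_le_tsum fun p => ?_) (tsum_prefixFree_le_one
      {p | (U p []).Dom} fun p hp q hq => hU.prefixFree [] p q hp hq)
    by_cases h : ∃ b a, a ∈ firstComponent U pair b p
    · obtain ⟨b, a, ha⟩ := h
      have hp := (mem_firstComponent hpair).1 ha
      have hdom : p ∈ {p | (U p []).Dom} := Part.dom_iff_mem.2 ⟨_, hp⟩
      rw [Set.indicator_of_mem hdom, tsum_eq_single b, hWmem ha]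
      -- The program `p` counts for the single string `b` only.
      exact fun b' hb' => hWzero fun a' ha' => hb'
        (hpair.injective (Part.mem_unique ((mem_firstComponent hpair).1 ha') hp)).2
    · have : ∀ b, W b p = 0 := fun b => hWzero fun a ha => h ⟨b, a, ha⟩
      simp [this]
  obtain ⟨c, hc⟩ := hU.exists_tsum_mul_two_pow_condK_le (g := fun b p =>
    (firstComponent U pair b p).map fun _ => p.length)
    (Partrec.map hfc (Computable.list_length.comp (Computable.snd.comp Computable.fst)).to₂) hsum
  change ∀ b, (∑' p, W b p) * 2 ^ condK U b [] ≤ 2 ^ c at hc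
  -- Under a condition `s` that is a program for `b`, a program `p` for `⟨a, b⟩` becomes the request
  -- for a program for `a` of length `l(p) + c - l(s)`.
  obtain ⟨d, hd⟩ := hU.exists_condK_le_of_requests (ι := Str) (g := fun s p => (U s []).bind fun b =>
    (firstComponent U pair b p).map fun a => (p.length + c - s.length, a)) <| by
      refine Partrec.bind (hU.partrec.comp Computable.fst (Computable.const [])) (Partrec.map
        (hfc.comp Computable.snd (Computable.snd.comp Computable.fst)) (Computable.pair ?_
          Computable.snd))
      have hp : Computable fun b : ((Str × Str) × Str) × Str => b.1.1.2 :=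
        Computable.snd.comp (Computable.fst.comp Computable.fst)
      have hs : Computable fun b : ((Str × Str) × Str) × Str => b.1.1.1 :=
        Computable.fst.comp (Computable.fst.comp Computable.fst)
      exact Primrec.nat_sub.to_comp.comp (computable_add (Computable.list_length.comp hp)
        (Computable.const c)) (Computable.list_length.comp hs)
  refine ⟨c + d, fun a b => ?_⟩
  set s := shortestProgram U hU b with hs
  have hb : b ∈ U s [] := mem_shortestProgram hU b
  have hl : s.length = condK U b [] := length_shortestProgram hU b
  -- The subtraction in the requests under `b*` is not truncated.
  have hlen : ∀ {a' p}, a' ∈ firstComponent U pair b p → s.length ≤ p.length + c := by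
    intro a' p h
    have h' : (2⁻¹ : ℝ≥0∞) ^ p.length * 2 ^ s.length ≤ 2 ^ c := by
      rw [← hWmem h, hl]
      exact (mul_le_mul_left (ENNReal.le_tsum p) _).trans (hc b)
    have h'' : (2 : ℝ≥0∞) ^ s.length ≤ 2 ^ (p.length + c) := by
      calc (2 : ℝ≥0∞) ^ s.length = 2 ^ p.length * (2⁻¹ ^ p.length * 2 ^ s.length) := by
            rw [← mul_assoc, ← mul_pow, ENNReal.mul_inv_cancel (by simp) (by simp), one_pow,
              one_mul]
        _ ≤ 2 ^ (p.length + c) := by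
            rw [pow_add]
            gcongr
    have h3 : 2 ^ s.length ≤ 2 ^ (p.length + c) := by exact_mod_cast h''
    exact (Nat.pow_le_pow_iff_right one_lt_two).1 h3
  have hreq : ∑' p, ⨆ y ∈ (U s []).bind fun b => (firstComponent U pair b p).map
      fun a => (p.length + c - s.length, a), (2⁻¹ : ℝ≥0∞) ^ y.1 ≤ 1 := by
    calc _ ≤ ∑' p, W b p * (2 ^ condK U b [] * 2⁻¹ ^ c) := by
          refine ENNReal.tsum_le_tsum fun p => iSup₂_le fun y hy => ?_
          obtain ⟨b', hb', hy⟩ := Part.mem_bind_iff.1 hy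
          obtain rfl := Part.mem_unique hb hb'
          obtain ⟨a', ha', rfl⟩ := (Part.mem_map_iff _).1 hy
          obtain ⟨j, hj⟩ := Nat.exists_eq_add_of_le (hlen ha')
          have hcancel : (2⁻¹ : ℝ≥0∞) ^ s.length * 2 ^ s.length = 1 := by
            rw [← mul_pow, ENNReal.inv_mul_cancel (by simp) (by simp), one_pow]
          rw [hWmem ha', ← hl]
          refine le_of_eq ?_
          calc (2⁻¹ : ℝ≥0∞) ^ (p.length + c - s.length)
              = 2⁻¹ ^ j * (2⁻¹ ^ s.length * 2 ^ s.length) := by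
                rw [hcancel, mul_one, hj, Nat.add_sub_cancel_left]
            _ = 2⁻¹ ^ (p.length + c) * 2 ^ s.length := by rw [hj, pow_add]; ring
            _ = _ := by rw [pow_add]; ring
      _ = ((∑' p, W b p) * 2 ^ condK U b []) * 2⁻¹ ^ c := by
          rw [ENNReal.tsum_mul_right, mul_assoc]
      _ ≤ 2 ^ c * 2⁻¹ ^ c := mul_le_mul_left (hc b) _
      _ = 1 := by rw [← mul_pow, ENNReal.mul_inv_cancel (by simp) (by simp), one_pow]
  obtain ⟨p, hp, hpl⟩ := hU.exists_length_eq_condK (pair a b) []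
  have ha : a ∈ firstComponent U pair b p := (mem_firstComponent hpair).2 hp
  have := hd s hreq p _ a (Part.mem_bind hb (Part.mem_map _ ha))
  have := hlen ha
  omega

end PrefixComplexity

theorem mainTheorem7 (U : PrefixComplexity.Machine) (hU : PrefixComplexity.IsReferenceMachine U)
    (pair : PrefixComplexity.Str → PrefixComplexity.Str → PrefixComplexity.Str)
    (hpair : PrefixComplexity.IsPairing pair) :
    ∃ c : ℕ, ∀ x y z : PrefixComplexity.Str,
      PrefixComplexity.condK U x (PrefixComplexity.shortestProgram U hU y) ≤
          PrefixComplexity.condK U (pair x z) (PrefixComplexity.shortestProgram U hU y) + c ∧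
        PrefixComplexity.condK U (pair x z) (PrefixComplexity.shortestProgram U hU y) ≤
          PrefixComplexity.condK U z (PrefixComplexity.shortestProgram U hU y) +
            PrefixComplexity.condK U x (PrefixComplexity.shortestProgram U hU z) + c := by
  open PrefixComplexity in
  have h2 := hpair.injective_uncurry
  have h3 : Function.Injective fun a : Str × Str × Str => pair (pair a.1 a.2.1) a.2.2 := by
    rintro ⟨x, y, z⟩ ⟨x', y', z'⟩ h
    obtain ⟨h', rfl⟩ := hpair.injective h
    obtain ⟨rfl, rfl⟩ := hpair.injective h'
    rfl
  have fst : Computable fun a : Str × Str × Str => a.1 := Computable.fst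
  have snd : Computable fun a : Str × Str × Str => a.2.1 := Computable.fst.comp Computable.snd
  have trd : Computable fun a : Str × Str × Str => a.2.2 := Computable.snd.comp Computable.snd
  obtain ⟨c₁, project⟩ := hU.exists_condK_comp_le hpair.computable h2 Computable.fst
  obtain ⟨c₂, swap⟩ := hU.exists_condK_comp_le hpair.computable h2
    (hpair.computable.comp Computable.snd Computable.fst)
  obtain ⟨c₃, permute⟩ := hU.exists_condK_comp_le
    (hpair.computable.comp (hpair.computable.comp fst snd) trd) h3
    (hpair.computable.comp (hpair.computable.comp fst trd) snd)
  obtain ⟨c₄, chain⟩ := hU.exists_condK_pair_le hpair.computable (cond := fun _ p => p)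
    Computable.snd
  obtain ⟨c₅, join⟩ := hU.exists_condK_pair_le hpair.computable (cond := fun s _ => s)
    Computable.fst
  obtain ⟨c₆, split⟩ := hU.exists_condK_shortestProgram_add_le hpair
  have chain' : ∀ u v, condK U (pair v u) [] ≤
      condK U u [] + condK U v (shortestProgram U hU u) + c₄ := fun u v => by
    rw [← length_shortestProgram hU u]
    exact chain [] _ u v (mem_shortestProgram hU u)
  have join' : ∀ u v s, condK U (pair v u) s ≤ condK U u s + condK U v s + c₅ := fun u v s => by
    obtain ⟨p, hp, hl⟩ := hU.exists_length_eq_condK u s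
    rw [← hl]
    exact join s p u v hp
  refine ⟨c₁ + c₂ + c₃ + 2 * c₄ + c₅ + 2 * c₆, fun x y z => ⟨?_, ?_⟩⟩
  · have := project (x, z) (shortestProgram U hU y)
    simp only at this
    omega
  · -- `K(x, z | y*) + K(y) ≤ K(x, y, z) ≤ K(z) + K(x | z*) + K(y | z*)`
    have e₁ := split (pair x z) y
    have e₂ := permute (x, y, z) []
    have e₃ := chain' z (pair x y)
    have e₄ := join' y x (shortestProgram U hU z)
    -- `K(y | z*) + K(z) ≤ K(y, z) ≤ K(y) + K(z | y*)`
    have e₅ := split y z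
    have e₆ := swap (z, y) []
    have e₇ := chain' y z
    simp only at e₂ e₆
    omega
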